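/- For every decreasing (that is, non-increasing) function $\eta:\mathbf{N}\to(0,1)$ there is some $M=M(\eta)\in\mathbf{N}$ such that the following holds. Every finite group $G$ has a normal subgroup $H$ such that (1) $|[H,H]|\leq M$, and (2) with at most $\eta(|[H,H]|)\,|G|^2$ exceptions, every pair $(x,y)\in G^2$ such that $[x,y]\in[H,H]$ is contained in $H^2$; that is, the number of pairs $(x,y)\in G^2\setminus H^2$ with $[x,y]\in[H,H]$ is at most $\eta(|[H,H]|)\,|G|^2$. Here $[x,y]=x^{-1}y^{-1}xy$, and $[H,H]$ is the subgroup generated by all commutators $[h,k]$ with $h,k\in H$. -/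

import Mathlib

/-! Let `X s` be the set of elements with class size at most `s`. If `X s₀` has small density, `H =
⊥` works: an element with a large class commutes with few others. Otherwise take bounds `σ j`
growing fast. Each strict growth of `X (σ j)`, counted at every second index, gives a new disjoint
translate of `X (σ 0)`, so by density some step adds nothing. Since class sizes are
submultiplicative, that `X (σ j)` is a normal subgroup `H`, and Neumann's theorem bounds `⁅H, H⁆` in
terms of `σ j`. An element outside `H` has class size above `σ (j + 1)`, chosen so large that few of
its commutators land in `⁅H, H⁆`. -/

/-- The size of the conjugacy class of an element is the index of its centralizer. -/
theorem ncard_conjugatesOf {G : Type*} [Group G] (x : G) :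
    (conjugatesOf x).ncard = (Subgroup.centralizer {x}).index := by
  have h1 : Subgroup.centralizer {x} =
      (MulAction.stabilizer (ConjAct G) x).comap (ConjAct.toConjAct (G := G)).toMonoidHom := by
    ext g
    simp [Subgroup.mem_centralizer_singleton_iff, ConjAct.smul_def, mul_inv_eq_iff_eq_mul]
  rw [h1, Subgroup.index_comap_of_surjective _ (ConjAct.toConjAct (G := G)).surjective,
    MulAction.index_stabilizer, ConjAct.orbit_eq_carrier_conjClasses]
  rfl

theorem index_centralizer_mul_le {G : Type*} [Group G] [Finite G] (x y : G) :
    (Subgroup.centralizer {x * y}).index ≤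
      (Subgroup.centralizer {x}).index * (Subgroup.centralizer {y}).index := by
  refine le_trans (Subgroup.index_antitone ?_) Subgroup.index_inf_le
  intro g hg
  simp only [Subgroup.mem_inf, Subgroup.mem_centralizer_singleton_iff] at hg ⊢
  rw [← mul_assoc, hg.1, mul_assoc, hg.2, mul_assoc]

theorem index_centralizer_inv {G : Type*} [Group G] (x : G) :
    (Subgroup.centralizer {x⁻¹}).index = (Subgroup.centralizer {x}).index := by
  congr 1
  ext g
  simp only [Subgroup.mem_centralizer_singleton_iff]
  exact Commute.inv_right_iff (a := g) (b := x)

theorem index_centralizer_conj {G : Type*} [Group G] (x g : G) :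
    (Subgroup.centralizer {g * x * g⁻¹}).index = (Subgroup.centralizer {x}).index := by
  have h : IsConj x (g * x * g⁻¹) := isConj_iff.2 ⟨g, rfl⟩
  rw [← ncard_conjugatesOf, ← ncard_conjugatesOf, h.conjugatesOf_eq]

theorem index_centralizer_coe_le {G : Type*} [Group G] [Finite G] (H : Subgroup G) (h : H) :
    (Subgroup.centralizer {h}).index ≤ (Subgroup.centralizer {(h : G)}).index := by
  have h1 : (Subgroup.centralizer {(h : G)}).subgroupOf H ≤ Subgroup.centralizer {h} := by
    intro g hg
    rw [Subgroup.mem_subgroupOf, Subgroup.mem_centralizer_singleton_iff] at hg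
    rw [Subgroup.mem_centralizer_singleton_iff]
    exact Subtype.ext (by simpa using hg)
  refine (Subgroup.index_antitone h1).trans ?_
  refine (Subgroup.relIndex_le_of_le_right le_top ?_).trans (Subgroup.relIndex_top_right _).le
  rw [Subgroup.relIndex_top_right]
  exact Subgroup.FiniteIndex.index_ne_zero

/-! ### Neumann's theorem -/

open scoped Pointwise in
/-- If all conjugacy classes have size at most `d`, then there are few commutators. -/
theorem card_commutatorSet_le {G : Type*} [Group G] [Finite G] {d : ℕ}
    (hd : ∀ x : G, (Subgroup.centralizer {x}).index ≤ d) :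
    Nat.card (commutatorSet G) ≤ d ^ d * (d * d * d) := by
  classical
  have hd' : ∀ x : G, (conjugatesOf x).ncard ≤ d := fun x => by
    rw [ncard_conjugatesOf]; exact hd x
  obtain ⟨a, ha⟩ := Finite.exists_max fun x : G => (conjugatesOf x).ncard
  have ht : ∀ b : conjugatesOf a, ∃ t : G, t * a * t⁻¹ = b := fun b => isConj_iff.1 b.2
  choose t ht using ht
  have : Fintype (conjugatesOf a) := Fintype.ofFinite _
  set U : Subgroup G := ⨅ b, Subgroup.centralizer {t b} with hU
  have hd1 : 1 ≤ d := le_trans (Nat.one_le_iff_ne_zero.2 Subgroup.FiniteIndex.index_ne_zero) (hd 1)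
  have hUindex : U.index ≤ d ^ d := by
    refine (Subgroup.index_iInf_le _).trans ?_
    refine (Finset.prod_le_pow_card _ _ d fun b _ => hd _).trans ?_
    refine Nat.pow_le_pow_right hd1 ?_
    rw [Finset.card_univ, ← Nat.card_eq_fintype_card]
    exact hd' a
  -- `u` commutes with every `t b`, so the class of `u * a` contains `u` times that of `a`;
  -- maximality of the latter forces equality.
  have hua : ∀ u ∈ U, conjugatesOf (u * a) = (u * ·) '' conjugatesOf a := by
    intro u hu
    symm
    apply Set.eq_of_subset_of_ncard_le
    · rintro _ ⟨b, hb, rfl⟩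
      refine isConj_iff.2 ⟨t ⟨b, hb⟩, ?_⟩
      have h1 := Subgroup.mem_iInf.1 hu ⟨b, hb⟩
      rw [Subgroup.mem_centralizer_singleton_iff] at h1
      rw [← mul_assoc, ← h1, mul_assoc, mul_assoc, ← mul_assoc (t _) a, ht]
    · rw [Set.ncard_image_of_injective _ (mul_right_injective u)]
      exact ha _
    · exact Set.toFinite _
  have hw : ∀ u ∈ U, ∀ y : G, u⁻¹ * y * u * y⁻¹ ∈ conjugatesOf a / conjugatesOf a := by
    intro u hu y
    have h1 : y * (u * a) * y⁻¹ ∈ conjugatesOf (u * a) := isConj_iff.2 ⟨y, rfl⟩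
    rw [hua u hu] at h1
    obtain ⟨b, hb, hb'⟩ := h1
    refine Set.mem_div.2 ⟨b, hb, y * a * y⁻¹, isConj_iff.2 ⟨y, rfl⟩, ?_⟩
    have h2 : b = u⁻¹ * (y * (u * a) * y⁻¹) := by rw [← hb']; group
    rw [h2, div_eq_mul_inv]; group
  have : Fintype (G ⧸ U) := Fintype.ofFinite _
  -- With `s` representing `x U` and `u = x⁻¹ * s`, `⁅x, y⁆ = s * (u⁻¹ * y * u * y⁻¹) * (y * s⁻¹ *
  -- y⁻¹)`.
  have hcov : commutatorSet G ⊆ ⋃ q : G ⧸ U,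
      (q.out * ·) '' ((conjugatesOf a / conjugatesOf a) * conjugatesOf (q.out)⁻¹) := by
    rintro _ ⟨x, y, rfl⟩
    refine Set.mem_iUnion.2 ⟨(x : G ⧸ U), ?_⟩
    set s := (x : G ⧸ U).out with hs
    have hsx : x⁻¹ * s ∈ U := by
      rw [← QuotientGroup.eq, hs, QuotientGroup.out_eq']
    refine ⟨_, Set.mul_mem_mul (hw _ hsx y) (isConj_iff.2 ⟨y, rfl⟩), ?_⟩
    simp only [commutatorElement_def]
    group
  rw [Nat.card_coe_set_eq]
  refine (Set.ncard_le_ncard hcov).trans ((Set.ncard_iUnion_le_of_fintype _).trans ?_)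
  have hq : ∀ q : G ⧸ U, ((q.out * ·) ''
      ((conjugatesOf a / conjugatesOf a) * conjugatesOf (q.out)⁻¹)).ncard ≤ d * d * d := by
    intro q
    rw [Set.ncard_image_of_injective _ (mul_right_injective _), ← Nat.card_coe_set_eq]
    refine Set.natCard_mul_le.trans (Nat.mul_le_mul (Set.natCard_div_le.trans
      (Nat.mul_le_mul ?_ ?_)) ?_) <;> exact hd' _
  refine (Finset.sum_le_card_nsmul _ _ _ fun q _ => hq q).trans ?_
  rw [smul_eq_mul, Finset.card_univ, ← Nat.card_eq_fintype_card]
  exact Nat.mul_le_mul_right _ hUindex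

/-- B. H. Neumann: a group with bounded conjugacy classes has bounded derived subgroup. -/
theorem exists_card_commutator_le (s : ℕ) :
    ∃ B : ℕ, ∀ (G : Type*) [Group G] [Finite G] (H : Subgroup G),
      (∀ x ∈ H, (Subgroup.centralizer {x}).index ≤ s) → Nat.card ↥⁅H, H⁆ ≤ B := by
  refine ⟨(Finset.range (s ^ s * (s * s * s) + 1)).sup Subgroup.cardCommutatorBound, ?_⟩
  intro G _ _ H hH
  rw [← Subgroup.map_subtype_commutator, Subgroup.card_map_of_injective H.subtype_injective]
  refine (Subgroup.card_commutator_le_of_finite_commutatorSet H).trans ?_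
  apply Finset.le_sup (f := Subgroup.cardCommutatorBound)
  rw [Finset.mem_range, Nat.lt_succ_iff]
  exact card_commutatorSet_le fun x => (index_centralizer_coe_le H x).trans (hH _ x.2)

/-! ### Counting pairs by their commutator -/

/-- Two solutions `y`, `z` differ by a factor `y * z⁻¹` centralizing `x`. -/
theorem ncard_setOf_commutator_eq_le {G : Type*} [Group G] [Finite G] (x k : G) :
    {y : G | x⁻¹ * y⁻¹ * x * y = k}.ncard ≤ Nat.card (Subgroup.centralizer {x}) := by
  rcases Set.eq_empty_or_nonempty {y : G | x⁻¹ * y⁻¹ * x * y = k} with h | ⟨z, hz⟩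
  · simp [h]
  · rw [← SetLike.coe_sort_coe, Nat.card_coe_set_eq]
    refine Set.ncard_le_ncard_of_injOn (· * z⁻¹) ?_ (mul_left_injective _).injOn
    intro y hy
    rw [SetLike.mem_coe, Subgroup.mem_centralizer_singleton_iff]
    have h1 : x⁻¹ * y⁻¹ * x * y = x⁻¹ * z⁻¹ * x * z := by
      exact Eq.trans hy (Eq.symm hz)
    have h2 : x * y = y * z⁻¹ * x * z := by
      calc x * y = y * x * (x⁻¹ * y⁻¹ * x * y) := by group
        _ = y * z⁻¹ * x * z := by rw [h1]; group
    rw [← mul_assoc, h2]; group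

/-- Few pairs whose first entry has a large class have their commutator in a small subgroup. -/
theorem ncard_commutator_mem_fst_le {G : Type*} [Group G] [Finite G] (L : Subgroup G) {s : ℕ}
    (hs : 0 < s) :
    ({p : G × G | p.1⁻¹ * p.2⁻¹ * p.1 * p.2 ∈ L ∧
      ¬ (Subgroup.centralizer {p.1}).index ≤ s}.ncard : ℝ) ≤
        Nat.card L / s * (Nat.card G : ℝ) ^ 2 := by
  classical
  have : Fintype G := Fintype.ofFinite G
  have hcov : {p : G × G | p.1⁻¹ * p.2⁻¹ * p.1 * p.2 ∈ L ∧
      ¬ (Subgroup.centralizer {p.1}).index ≤ s} ⊆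
      ⋃ x : G, ⋃ k : L, {p : G × G | p.1 = x ∧ p.1⁻¹ * p.2⁻¹ * p.1 * p.2 = k ∧
        ¬ (Subgroup.centralizer {p.1}).index ≤ s} := by
    intro p hp
    simp only [Set.mem_iUnion]
    exact ⟨p.1, ⟨_, hp.1⟩, rfl, rfl, hp.2⟩
  have hfib : ∀ (x : G) (k : L), ({p : G × G | p.1 = x ∧ p.1⁻¹ * p.2⁻¹ * p.1 * p.2 = k ∧
        ¬ (Subgroup.centralizer {p.1}).index ≤ s}.ncard : ℝ) ≤ Nat.card G / s := by
    intro x k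
    by_cases hx : (Subgroup.centralizer {x}).index ≤ s
    · have : {p : G × G | p.1 = x ∧ p.1⁻¹ * p.2⁻¹ * p.1 * p.2 = k ∧
        ¬ (Subgroup.centralizer {p.1}).index ≤ s} = ∅ := by
        ext ⟨a, b⟩
        simp only [Set.mem_ofPred_eq, Set.mem_empty_iff_false, iff_false]
        rintro ⟨rfl, -, h⟩
        exact h hx
      rw [this]
      simp only [Set.ncard_empty, Nat.cast_zero]
      positivity
    · have h1 : {p : G × G | p.1 = x ∧ p.1⁻¹ * p.2⁻¹ * p.1 * p.2 = k ∧
          ¬ (Subgroup.centralizer {p.1}).index ≤ s}.ncard ≤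
          Nat.card (Subgroup.centralizer {x}) := by
        refine le_trans (Set.ncard_le_ncard_of_injOn Prod.snd ?_ ?_)
          (ncard_setOf_commutator_eq_le x (k : G))
        · rintro ⟨a, b⟩ ⟨rfl, h, -⟩
          exact h
        · rintro ⟨a, b⟩ ⟨rfl, -⟩ ⟨a', b'⟩ ⟨h, -⟩ hb
          exact Prod.ext h.symm hb
      rw [le_div_iff₀ (by positivity)]
      rw [← Subgroup.card_mul_index (Subgroup.centralizer {x})]
      push_cast
      have h2 : (s : ℝ) ≤ ((Subgroup.centralizer {x}).index : ℝ) := by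
        exact_mod_cast (not_le.1 hx).le
      gcongr
  have hsum : ∀ x : G, ((⋃ k : L, {p : G × G | p.1 = x ∧ p.1⁻¹ * p.2⁻¹ * p.1 * p.2 = k ∧
        ¬ (Subgroup.centralizer {p.1}).index ≤ s}).ncard : ℝ) ≤
        Nat.card L * (Nat.card G / s) := by
    intro x
    refine le_trans (Nat.cast_le.2 (Set.ncard_iUnion_le_of_fintype _)) ?_
    push_cast
    refine (Finset.sum_le_card_nsmul _ _ _ fun k _ => hfib x k).trans ?_
    simp [Nat.card_eq_fintype_card]
  refine le_trans (Nat.cast_le.2 ((Set.ncard_le_ncard hcov).trans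
    (Set.ncard_iUnion_le_of_fintype _))) ?_
  push_cast
  refine (Finset.sum_le_card_nsmul _ _ _ fun x _ => hsum x).trans (le_of_eq ?_)
  rw [nsmul_eq_mul, Finset.card_univ, ← Nat.card_eq_fintype_card]
  ring

theorem ncard_commutator_mem_le {G : Type*} [Group G] [Finite G] (L : Subgroup G) {s : ℕ}
    (hs : 0 < s) :
    ({p : G × G | p.1⁻¹ * p.2⁻¹ * p.1 * p.2 ∈ L ∧
      ¬ ((Subgroup.centralizer {p.1}).index ≤ s ∧
        (Subgroup.centralizer {p.2}).index ≤ s)}.ncard : ℝ) ≤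
        2 * Nat.card L / s * (Nat.card G : ℝ) ^ 2 := by
  set A := {p : G × G | p.1⁻¹ * p.2⁻¹ * p.1 * p.2 ∈ L ∧
      ¬ (Subgroup.centralizer {p.1}).index ≤ s} with hA
  have hcov : {p : G × G | p.1⁻¹ * p.2⁻¹ * p.1 * p.2 ∈ L ∧
      ¬ ((Subgroup.centralizer {p.1}).index ≤ s ∧
        (Subgroup.centralizer {p.2}).index ≤ s)} ⊆ A ∪ Prod.swap '' A := by
    rintro ⟨x, y⟩ ⟨h1, h2⟩
    rw [not_and_or] at h2
    rcases h2 with h2 | h2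
    · exact Or.inl ⟨h1, h2⟩
    -- Swapping the entries inverts the commutator.
    · refine Or.inr ⟨(y, x), ⟨?_, h2⟩, rfl⟩
      have := L.inv_mem h1
      simpa [mul_assoc] using this
  have h1 : {p : G × G | p.1⁻¹ * p.2⁻¹ * p.1 * p.2 ∈ L ∧
      ¬ ((Subgroup.centralizer {p.1}).index ≤ s ∧
        (Subgroup.centralizer {p.2}).index ≤ s)}.ncard ≤ A.ncard + A.ncard := by
    refine (Set.ncard_le_ncard hcov).trans ((Set.ncard_union_le _ _).trans ?_)
    exact Nat.add_le_add_left (Set.ncard_image_le A.toFinite) _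
  have h2 := ncard_commutator_mem_fst_le L hs
  rw [← hA] at h2
  calc _ ≤ ((A.ncard + A.ncard : ℕ) : ℝ) := by exact_mod_cast h1
    _ ≤ _ := by
      push_cast
      refine (add_le_add h2 h2).trans (le_of_eq ?_)
      ring

/-! ### Stabilization of the bounded-class sets -/

/-- The elements with class size at most `s` form a subgroup once the bound `s ^ 2` adds none. -/
def boundedClassSubgroup {G : Type*} [Group G] [Finite G] (s : ℕ) (hs : 0 < s)
    (h : ∀ x : G, (Subgroup.centralizer {x}).index ≤ s * s →
      (Subgroup.centralizer {x}).index ≤ s) : Subgroup G where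
  carrier := {x | (Subgroup.centralizer {x}).index ≤ s}
  mul_mem' {x y} hx hy := h _ ((index_centralizer_mul_le x y).trans (Nat.mul_le_mul hx hy))
  one_mem' := by
    have : Subgroup.centralizer {(1 : G)} = ⊤ := by
      ext g; simp [Subgroup.mem_centralizer_singleton_iff]
    simpa [this] using Nat.succ_le_of_lt hs
  inv_mem' {x} hx := by
    rw [Set.mem_ofPred_eq, index_centralizer_inv]; exact hx

/-- Along a rapidly growing sequence of bounds, the set of elements of bounded class size
cannot grow often if it is dense. -/
theorem exists_index_centralizer_stable {G : Type*} [Group G] [Finite G] {σ : ℕ → ℕ}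
    (hσ : ∀ j, σ j ^ 3 ≤ σ (j + 1)) {N : ℕ}
    (hN : Nat.card G < N * {x : G | (Subgroup.centralizer {x}).index ≤ σ 0}.ncard) :
    ∃ j < 2 * N, ∀ x : G, (Subgroup.centralizer {x}).index ≤ σ (j + 1) →
      (Subgroup.centralizer {x}).index ≤ σ j := by
  by_contra! hcon
  have hmono : Monotone σ := monotone_nat_of_le_succ fun j =>
    (Nat.le_self_pow (by norm_num) _).trans (hσ j)
  -- Only even indices are used: the step from `2 * i + 1` to `2 * i + 2` absorbs a product of three
  -- factors.
  have hex : ∀ i : Fin N, ∃ x : G, (Subgroup.centralizer {x}).index ≤ σ (2 * i + 1) ∧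
      σ (2 * i) < (Subgroup.centralizer {x}).index := fun i => hcon (2 * i) (by omega)
  choose h hle hlt using hex
  set X := {x : G | (Subgroup.centralizer {x}).index ≤ σ 0}
  have key : ∀ i j : Fin N, i < j → ∀ x ∈ X, ∀ y ∈ X, h i * x ≠ h j * y := by
    intro i j hij x hx y hy heq
    have h1 : h j = h i * x * y⁻¹ := by rw [heq]; group
    have h2 : (Subgroup.centralizer {h j}).index ≤ σ (2 * i + 1) * σ (2 * i + 1) * σ (2 * i + 1) := by
      rw [h1]
      refine (index_centralizer_mul_le _ _).trans (Nat.mul_le_mul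
        ((index_centralizer_mul_le _ _).trans (Nat.mul_le_mul (hle i) ?_)) ?_)
      · exact le_trans hx (hmono (Nat.zero_le _))
      · rw [index_centralizer_inv]
        exact le_trans hy (hmono (Nat.zero_le _))
    have h3 : σ (2 * i + 1) * σ (2 * i + 1) * σ (2 * i + 1) ≤ σ (2 * i + 2) :=
      le_trans (le_of_eq (by ring)) (hσ (2 * i + 1))
    have h4 : σ (2 * i + 2) ≤ σ (2 * j) := hmono (by have : (i : ℕ) < j := hij; omega)
    exact absurd (hlt j) (not_lt.2 (h2.trans (h3.trans h4)))
  have hinj : Function.Injective fun p : Fin N × X => h p.1 * (p.2 : G) := by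
    rintro ⟨i, x⟩ ⟨j, y⟩ heq
    rcases lt_trichotomy i j with hij | rfl | hij
    · exact absurd heq (key i j hij x x.2 y y.2)
    · exact Prod.ext rfl (Subtype.ext (mul_left_cancel heq))
    · exact absurd heq.symm (key j i hij y y.2 x x.2)
  have := Nat.card_le_card_of_injective _ hinj
  rw [Nat.card_prod, Nat.card_fin, Nat.card_coe_set_eq] at this
  exact absurd hN (not_lt.2 this)

theorem mainTheorem6 (η : ℕ → ℝ) (hη : Antitone η) (hη01 : ∀ n, η n ∈ Set.Ioo (0 : ℝ) 1) :
    ∃ M : ℕ, ∀ (G : Type*) [Group G] [Finite G],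
      ∃ H : Subgroup G, H.Normal ∧
        Nat.card ↥⁅H, H⁆ ≤ M ∧
        (({p : G × G | p.1⁻¹ * p.2⁻¹ * p.1 * p.2 ∈ ⁅H, H⁆ ∧ ¬(p.1 ∈ H ∧ p.2 ∈ H)}.ncard : ℕ) : ℝ)
          ≤ η (Nat.card ↥⁅H, H⁆) * (Nat.card G : ℝ) ^ 2 := by
  choose B hB using exists_card_commutator_le
  have hpos : ∀ n, 0 < η n := fun n => (hη01 n).1
  -- In the sparse case, large classes and `X` each cost at most `η 1 / 2`.
  obtain ⟨s₀, hs₀⟩ := exists_nat_gt (2 / η 1)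
  obtain ⟨N, hN⟩ := exists_nat_gt (2 / η 1)
  have hs₀pos : 0 < s₀ := by
    have : (0 : ℝ) < s₀ := lt_trans (div_pos two_pos (hpos 1)) hs₀
    exact_mod_cast this
  -- The cube serves stabilization; the ceiling makes `2 * B / σ (j + 1)` at most `η B`, where `B =
  -- B (σ j)`.
  let σ : ℕ → ℕ := fun j => Nat.rec s₀ (fun _ s => max (s ^ 3) ⌈2 * B s / η (B s)⌉₊) j
  have hσ : ∀ j, σ j ^ 3 ≤ σ (j + 1) := fun j => le_max_left _ _
  have hσ' : ∀ j, 2 * B (σ j) / η (B (σ j)) ≤ σ (j + 1) := fun j =>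
    (Nat.le_ceil _).trans (Nat.cast_le.2 (le_max_right _ _))
  have hσpos : ∀ j, 0 < σ j := by
    intro j
    induction j with
    | zero => exact hs₀pos
    | succ j ih => exact lt_of_lt_of_le (by positivity) (hσ j)
  refine ⟨max 1 ((Finset.range (2 * N)).sup fun j => B (σ j)), ?_⟩
  intro G _ _
  by_cases hX : Nat.card G < N * {x : G | (Subgroup.centralizer {x}).index ≤ σ 0}.ncard
  · obtain ⟨j, hj, hstab⟩ := exists_index_centralizer_stable hσ hX
    have hsq : σ j * σ j ≤ σ (j + 1) := by
      refine le_trans ?_ (hσ j)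
      rw [← sq]
      exact Nat.pow_le_pow_right (hσpos j) (by norm_num)
    let H := boundedClassSubgroup (G := G) (σ j) (hσpos j) fun x hx => hstab x (hx.trans hsq)
    have hcard : Nat.card ↥⁅H, H⁆ ≤ B (σ j) := hB _ G H fun x hx => hx
    refine ⟨H, ⟨fun x hx g => ?_⟩, ?_, ?_⟩
    · change (Subgroup.centralizer {g * x * g⁻¹}).index ≤ σ j
      rw [index_centralizer_conj]
      exact hx
    · exact hcard.trans (le_max_of_le_right
        (Finset.le_sup (f := fun j => B (σ j)) (Finset.mem_range.2 hj)))
    · have hsub : {p : G × G | p.1⁻¹ * p.2⁻¹ * p.1 * p.2 ∈ ⁅H, H⁆ ∧ ¬(p.1 ∈ H ∧ p.2 ∈ H)} ⊆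
          {p : G × G | p.1⁻¹ * p.2⁻¹ * p.1 * p.2 ∈ ⁅H, H⁆ ∧
            ¬ ((Subgroup.centralizer {p.1}).index ≤ σ (j + 1) ∧
              (Subgroup.centralizer {p.2}).index ≤ σ (j + 1))} :=
        fun p hp => ⟨hp.1, fun h => hp.2 ⟨hstab _ h.1, hstab _ h.2⟩⟩
      refine le_trans (Nat.cast_le.2 (Set.ncard_le_ncard hsub)) ?_
      refine (ncard_commutator_mem_le _ (hσpos (j + 1))).trans ?_
      gcongr
      -- Monotonicity lets the bound on `⁅H, H⁆` replace its unknown order.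
      refine le_trans ?_ (hη hcard)
      have h1 : (0 : ℝ) < σ (j + 1) := by exact_mod_cast hσpos (j + 1)
      have h2 := hσ' j
      rw [div_le_iff₀ (hpos _)] at h2
      rw [div_le_iff₀ h1]
      have h3 : (Nat.card ↥⁅H, H⁆ : ℝ) ≤ B (σ j) := by exact_mod_cast hcard
      linarith
  · refine ⟨⊥, inferInstance, ?_, ?_⟩
    · simp
    have hbot : Nat.card ↥⁅(⊥ : Subgroup G), (⊥ : Subgroup G)⁆ = 1 := by simp
    rw [hbot]
    set X := {x : G | (Subgroup.centralizer {x}).index ≤ σ 0} with hXdef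
    set L := ⁅(⊥ : Subgroup G), (⊥ : Subgroup G)⁆ with hL
    have hsub : {p : G × G | p.1⁻¹ * p.2⁻¹ * p.1 * p.2 ∈ L ∧
          ¬(p.1 ∈ (⊥ : Subgroup G) ∧ p.2 ∈ (⊥ : Subgroup G))} ⊆
        {p : G × G | p.1⁻¹ * p.2⁻¹ * p.1 * p.2 ∈ L ∧
          ¬ (Subgroup.centralizer {p.1}).index ≤ s₀} ∪ X ×ˢ Set.univ := by
      intro p hp
      rcases em (p.1 ∈ X) with h | h
      · exact Or.inr ⟨h, trivial⟩
      · exact Or.inl ⟨hp.1, h⟩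
    have h1 := ncard_commutator_mem_fst_le L hs₀pos
    rw [hbot] at h1
    have h2 : (N : ℝ) * X.ncard ≤ Nat.card G := by exact_mod_cast not_lt.1 hX
    have h3 : (X.ncard : ℝ) ≤ η 1 / 2 * Nat.card G := by
      have h4 : 2 / η 1 * X.ncard ≤ Nat.card G :=
        le_trans (mul_le_mul_of_nonneg_right hN.le (Nat.cast_nonneg _)) h2
      rw [div_mul_eq_mul_div, div_le_iff₀ (hpos 1)] at h4
      linarith
    have h5 : ((1 : ℕ) : ℝ) / s₀ ≤ η 1 / 2 := by
      rw [div_lt_iff₀ (hpos 1)] at hs₀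
      rw [div_le_iff₀ (by exact_mod_cast hs₀pos)]
      push_cast
      linarith
    have h6 := (Set.ncard_le_ncard hsub).trans (Set.ncard_union_le _ _)
    rw [Set.ncard_prod, Set.ncard_univ] at h6
    have h7 := (Nat.cast_le (α := ℝ)).2 h6
    push_cast at h7
    refine h7.trans ((add_le_add (h1.trans (mul_le_mul_of_nonneg_right h5 (by positivity)))
      (mul_le_mul_of_nonneg_right h3 (Nat.cast_nonneg _))).trans (le_of_eq ?_))
    ring
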